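/- A \emph{real algebraic curve} in $\mathbb{R}^2$ is a set $C\subset\mathbb{R}^2$ that is the common zero set of finitely many polynomials in $\mathbb{R}[x,y]$ and has real dimension $1$, i.e. the ring $\mathbb{R}[x,y]/I(C)$ has Krull dimension $1$, where $I(C)$ is the ideal of all polynomials vanishing on $C$ (so $C$ may be reducible and may have isolated points). Every such $C$ is the zero set of a single polynomial, and its \emph{degree} is the minimum degree of a polynomial $f\in\mathbb{R}[x,y]$ whose zero set is $C$. For a finite set $\mathcal P\subset\mathbb{R}^2$ and a finite set $\mathcal C$ of curves let $I(\mathcal P,\mathcal C)=\{(p,C)\in\mathcal P\times\mathcal C: p\in C\}$. There is an absolute constant $K>0$ such that the following two statements hold for all finite sets $A,B\subset\mathbb{R}$ with $\mathcal P:=A\times B$, all non-negative integers $d,M$, and every finite set $\mathcal C$ of real algebraic curves in $\mathbb{R}^2$ of degree at most $d$ such that any two distinct points of $\mathcal P$ are contained in at most $M$ curves of $\mathcal C$. (i) If no curve of $\mathcal C$ contains a horizontal or vertical line, $d^4|\mathcal C|\le M|\mathcal P|^2$, $|A|\le|B|$, and $d|\mathcal C|\ge M|B|^2/|A|$ (a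 condition that is void if $A=\emptyset$), then $$|I(\mathcal P,\mathcal C)|\le K\, d^{2/3}M^{1/3}|\mathcal P|^{2/3}|\mathcal C|^{2/3}.$$ (ii) If $|A|=|B|$ (and with no other condition on sizes or on lines), then $$|I(\mathcal P,\mathcal C)|\le K\left(d^{2/3}M^{1/3}|\mathcal P|^{2/3}|\mathcal C|^{2/3}+M(\log M+\log d)|\mathcal P|+d^2|\mathcal C|\right),$$ where $\log$ is the natural logarithm and $\log 0$ is read as $0$. -/

import Mathlib

noncomputable section

namespace RealIncidence

/-- The real plane `ℝ²`; only its set of points matters here. -/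
abbrev Plane : Type := Fin 2 → ℝ

/-- Real polynomials in two variables. -/
abbrev Poly2 : Type := MvPolynomial (Fin 2) ℝ

/-- The common zero set in `ℝ²` of a finite family of real polynomials. -/
def zeroSet (S : Finset Poly2) : Set Plane :=
  {p | ∀ f ∈ S, MvPolynomial.eval p f = 0}

/-- A real variety in `ℝ²`: the zero set of finitely many real polynomials. -/
def IsRealVariety (W : Set Plane) : Prop :=
  ∃ S : Finset Poly2, W = zeroSet S

/-- The real dimension of `W ⊆ ℝ²`: the Krull dimension of the coordinate ring `ℝ[x,y]/I(W)`,
where `I(W)` is the ideal of all real polynomials vanishing on `W`. -/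
def realDim (W : Set Plane) : WithBot ℕ∞ :=
  ringKrullDim (Poly2 ⧸ MvPolynomial.vanishingIdeal ℝ W)

/-- A real algebraic curve in `ℝ²`: a real variety of real dimension one. It may be reducible and
may have isolated points. -/
def IsRealCurve (W : Set Plane) : Prop :=
  IsRealVariety W ∧ realDim W = 1

/-- The degree of a real algebraic curve in `ℝ²`: the minimum degree of a single polynomial
whose zero set it is. -/
def curveDegree (W : Set Plane) : ℕ :=
  sInf {n | ∃ f : Poly2, W = zeroSet {f} ∧ f.totalDegree = n}

/-- `W` contains a horizontal line `y = b` or a vertical line `x = a`. -/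
def ContainsAxisParallelLine (W : Set Plane) : Prop :=
  (∃ b : ℝ, {p : Plane | p 1 = b} ⊆ W) ∨ (∃ a : ℝ, {p : Plane | p 0 = a} ⊆ W)

/-- The Cartesian product `A × B`, as a finite set of points of `ℝ²`. -/
def grid (A B : Finset ℝ) : Finset Plane :=
  (A ×ˢ B).map (finTwoArrowEquiv ℝ).symm.toEmbedding

open Classical in
/-- The set of incidences `{(p, c) ∈ P × C : p ∈ c}`. -/
def incidences (P : Finset Plane) (C : Finset (Set Plane)) : Finset (Plane × Set Plane) :=
  (P ×ˢ C).filter fun x => x.1 ∈ x.2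

open Classical in
/-- Any two distinct points of `P` are contained in at most `M` members of `C`. -/
def AtMostThroughTwo (P : Finset Plane) (C : Finset (Set Plane)) (M : ℕ) : Prop :=
  ∀ p ∈ P, ∀ q ∈ P, p ≠ q → (C.filter fun c => p ∈ c ∧ q ∈ c).card ≤ M

end RealIncidence

end

/-!
Cut the grid by axis-parallel lines into `r × r` cells. A curve of degree `d` that contains no
axis-parallel line meets only `O(dr + d²)` closed cells. Indeed, take an equation `g` of minimal
degree: an irreducible common factor of `g` and `∂g/∂y` would either vanish on a vertical line or
could be cancelled from `g` without changing the zero set, so `g` and `∂g/∂y` are coprime. A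
rightmost point of the curve in a cell lies on the boundary of the cell or is a zero of `∂g/∂y`;
there are `O(dr)` points of the first kind, at most `d` on each line, and at most `d²` of the second
kind by Bézout's theorem.

In each cell it meets, a curve has one incidence plus at most as many more as it contains pairs of
distinct grid points of the cell, and each pair lies on at most `M` curves. With the grid points
shared out evenly this gives `|I| ≤ O(|C|(dr + d²)) + O(M|P|²/r²)`, and the best `r` gives the main
term. If lines are allowed, they are split off the equations and their incidences are counted
separately.
-/

noncomputable section

namespace RealIncidence

open MvPolynomial

section Bezout

open Finset in
theorem card_degree_le (σ : Type*) [Fintype σ] (k : ℕ) :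
    Nat.card {n : σ →₀ ℕ | n.degree ≤ k} = (k + Fintype.card σ).choose (Fintype.card σ) := by
  classical
  have hset : {n : σ →₀ ℕ | n.degree ≤ k} =
      ((range (k + 1)).biUnion fun j => (univ : Finset σ).finsuppAntidiag j : Finset (σ →₀ ℕ)) := by
    ext n
    simp [Finsupp.degree_eq_sum]
  rw [hset, Nat.card_coe_set_eq, Set.ncard_coe_finset, card_biUnion]
  · simp only [card_finsuppAntidiag_nat_eq_multichoose, Finset.card_univ, Nat.sum_range_multichoose]
  · intro i _ j _ hij
    refine disjoint_left.mpr fun n hi hj => hij ?_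
    rw [mem_finsuppAntidiag] at hi hj
    exact hi.1.symm.trans hj.1

theorem finrank_restrictTotalDegree (σ R : Type*) [Fintype σ] [CommRing R] [Nontrivial R] (k : ℕ) :
    Module.finrank R (restrictTotalDegree σ R k) =
      (k + Fintype.card σ).choose (Fintype.card σ) := by
  rw [← card_degree_le]
  exact Module.finrank_eq_nat_card_basis (basisRestrictSupport R _)

variable {σ K : Type*} [Field K]

theorem exists_totalDegree_le_eval_eq_single (S : Finset (σ → K)) (p : σ → K) :
    ∃ f : MvPolynomial σ K, f.totalDegree ≤ S.card ∧ eval p f = 1 ∧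
      ∀ q ∈ S, q ≠ p → eval q f = 0 := by
  classical
  have hfactor (q : σ → K) : ∃ f : MvPolynomial σ K,
      f.totalDegree ≤ 1 ∧ eval p f = 1 ∧ (q ≠ p → eval q f = 0) := by
    by_cases hq : q = p
    · exact ⟨1, by simp, by simp, fun h => absurd hq h⟩
    · obtain ⟨i, hi⟩ := Function.ne_iff.mp (Ne.symm hq)
      refine ⟨C (p i - q i)⁻¹ * (X i - C (q i)), ?_, ?_, by simp⟩
      · refine (totalDegree_mul _ _).trans ?_
        rw [totalDegree_C, zero_add]
        exact (totalDegree_sub_C_le _ _).trans (totalDegree_X i).le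
      · simp [sub_ne_zero.mpr hi]
  choose F hdeg hone hzero using hfactor
  refine ⟨∏ q ∈ S, F q, ?_, ?_, fun q hq hqp => ?_⟩
  · refine (totalDegree_finsetProd _ _).trans ?_
    simpa using Finset.sum_le_sum fun q (_ : q ∈ S) => hdeg q
  · rw [map_prod, Finset.prod_eq_one fun q _ => hone q]
  · rw [map_prod, Finset.prod_eq_zero hq (hzero q hqp)]

/-- Evaluation at the points of `S`, as a linear map on the polynomials of degree at most `D`. -/
def evalOn (S : Finset (σ → K)) (D : ℕ) : restrictTotalDegree σ K D →ₗ[K] (S → K) :=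
  (LinearMap.pi fun p : S => (aeval (p : σ → K)).toLinearMap) ∘ₗ Submodule.subtype _

theorem evalOn_apply (S : Finset (σ → K)) (D : ℕ) (f : restrictTotalDegree σ K D) (p : S) :
    evalOn S D f p = eval (p : σ → K) (f : MvPolynomial σ K) := by
  simp [evalOn]

theorem evalOn_surjective {S : Finset (σ → K)} {D : ℕ} (hD : S.card ≤ D) :
    Function.Surjective (evalOn S D) := by
  classical
  rw [← LinearMap.range_eq_top, eq_top_iff, ← (Pi.basisFun K S).span_eq, Submodule.span_le]
  rintro _ ⟨p, rfl⟩
  obtain ⟨f, hdeg, hone, hzero⟩ := exists_totalDegree_le_eval_eq_single S p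
  refine ⟨⟨f, (mem_restrictTotalDegree _ _ _).mpr (hdeg.trans hD)⟩, ?_⟩
  ext q
  rw [evalOn_apply, Pi.basisFun_apply]
  by_cases hq : q = p
  · simp [hq, hone]
  · simp [hq, hzero q q.2 (fun h => hq (Subtype.ext h))]

/-- Multiplication by `f`, as a linear map from the polynomials of degree at most `k` to those of
degree at most `D`. -/
def mulRestrict (f : MvPolynomial σ K) {k D : ℕ} (h : f.totalDegree + k ≤ D) :
    restrictTotalDegree σ K k →ₗ[K] restrictTotalDegree σ K D :=
  (LinearMap.mulLeft K f).restrict fun g hg => by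
    rw [mem_restrictTotalDegree] at hg ⊢
    exact (totalDegree_mul _ _).trans (by lia)

theorem exists_syzygy {R : Type*} [CommRing R] [IsDomain R] [DecompositionMonoid R] {f g u v : R}
    (hg : g ≠ 0) (hfg : IsRelPrime f g) (h : f * u + g * v = 0) :
    ∃ w, u = g * w ∧ v = -(f * w) := by
  have hdvd : g ∣ f * u := ⟨-v, by linear_combination h⟩
  obtain ⟨w, rfl⟩ := hfg.symm.dvd_of_dvd_mul_left hdvd
  exact ⟨w, rfl, mul_left_cancel₀ hg (by linear_combination h)⟩

/-- The map `(u, v) ↦ f u + g v` on pairs of polynomials for which the result has degree at most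
`k + deg f + deg g`. -/
def sylvesterMap (f g : MvPolynomial σ K) (k : ℕ) :
    restrictTotalDegree σ K (k + g.totalDegree) × restrictTotalDegree σ K (k + f.totalDegree) →ₗ[K]
      restrictTotalDegree σ K (k + f.totalDegree + g.totalDegree) :=
  (mulRestrict f (by lia)).coprod (mulRestrict g (by lia))

theorem coe_sylvesterMap (f g : MvPolynomial σ K) (k : ℕ)
    (uv : restrictTotalDegree σ K (k + g.totalDegree) ×
      restrictTotalDegree σ K (k + f.totalDegree)) :
    (sylvesterMap f g k uv : MvPolynomial σ K) = f * uv.1 + g * uv.2 := rfl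

theorem finrank_ker_sylvesterMap_le [Finite σ] {f g : MvPolynomial σ K} (hg : g ≠ 0)
    (hfg : IsRelPrime f g) (k : ℕ) :
    Module.finrank K (LinearMap.ker (sylvesterMap f g k)) ≤
      Module.finrank K (restrictTotalDegree σ K k) := by
  let Ψ := LinearMap.prod (mulRestrict g (k := k) (D := k + g.totalDegree) (by lia))
    (-mulRestrict f (k := k) (D := k + f.totalDegree) (by lia))
  suffices hker : LinearMap.ker (sylvesterMap f g k) ≤ LinearMap.range Ψ from
    (Submodule.finrank_mono hker).trans (LinearMap.finrank_range_le Ψ)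
  rintro ⟨u, v⟩ huv
  have hsyz : f * (u : MvPolynomial σ K) + g * v = 0 :=
    congrArg Subtype.val (LinearMap.mem_ker.mp huv)
  obtain ⟨w, hu, hv⟩ := exists_syzygy hg hfg hsyz
  have hw : w ∈ restrictTotalDegree σ K k := by
    rw [mem_restrictTotalDegree]
    rcases eq_or_ne w 0 with rfl | hw0
    · simp
    · have hdeg := (mem_restrictTotalDegree _ _ _).mp u.2
      rw [hu, totalDegree_mul_of_isDomain hg hw0] at hdeg
      lia
  exact ⟨⟨w, hw⟩, Prod.ext (Subtype.ext hu.symm) (Subtype.ext hv.symm)⟩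

theorem range_sylvesterMap_le_ker_evalOn {f g : MvPolynomial σ K} {S : Finset (σ → K)}
    (hf : ∀ p ∈ S, eval p f = 0) (hg : ∀ p ∈ S, eval p g = 0) (k : ℕ) :
    LinearMap.range (sylvesterMap f g k) ≤ LinearMap.ker (evalOn S _) := by
  rintro _ ⟨uv, rfl⟩
  rw [LinearMap.mem_ker]
  ext p
  simp [evalOn_apply, coe_sylvesterMap, hf p p.2, hg p p.2]

theorem card_le_totalDegree_mul_totalDegree {f g : MvPolynomial (Fin 2) K} (hg : g ≠ 0)
    (hfg : IsRelPrime f g) {S : Finset (Fin 2 → K)} (hSf : ∀ p ∈ S, eval p f = 0)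
    (hSg : ∀ p ∈ S, eval p g = 0) : S.card ≤ f.totalDegree * g.totalDegree := by
  set k := S.card
  have heval := (evalOn S (k + f.totalDegree + g.totalDegree)).finrank_range_add_finrank_ker
  rw [LinearMap.range_eq_top.mpr (evalOn_surjective (by lia)), finrank_top,
    Module.finrank_fintype_fun_eq_card, Fintype.card_coe] at heval
  have hsyz := (sylvesterMap f g k).finrank_range_add_finrank_ker
  rw [Module.finrank_prod] at hsyz
  have hker := finrank_ker_sylvesterMap_le hg hfg k
  have hrange := Submodule.finrank_mono (range_sylvesterMap_le_ker_evalOn hSf hSg k)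
  have hdim (j : ℕ) : 2 * Module.finrank K (restrictTotalDegree (Fin 2) K j) =
      (j + 2) * (j + 1) := by
    rw [finrank_restrictTotalDegree, Fintype.card_fin, Nat.choose_two_right,
      Nat.mul_div_cancel' (Nat.even_mul_pred_self _).two_dvd]
    rfl
  nlinarith [hdim k, hdim (k + f.totalDegree), hdim (k + g.totalDegree),
    hdim (k + f.totalDegree + g.totalDegree)]

end Bezout

section Restriction

variable {σ R : Type*} [CommRing R]

theorem totalDegree_pderiv_lt {f : MvPolynomial σ R} {i : σ} (h : pderiv i f ≠ 0) :
    (pderiv i f).totalDegree < f.totalDegree := by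
  have hdeg : ∀ m ∈ (pderiv i f).support, m.degree < f.totalDegree := fun m hm => by
    rw [mem_support_iff, coeff_pderiv] at hm
    have hle : (m + Finsupp.single i 1).degree ≤ f.totalDegree :=
      le_totalDegree (mem_support_iff.mpr (left_ne_zero_of_mul hm))
    rwa [map_add, Finsupp.degree_single] at hle
  obtain ⟨m, hm⟩ := support_nonempty.mpr h
  exact (Finset.sup_lt_iff (Nat.zero_lt_of_lt (hdeg m hm))).mpr hdeg

theorem pderiv_eq_zero_of_dvd [IsDomain R] {f : MvPolynomial σ R} {i : σ} (h : f ∣ pderiv i f) :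
    pderiv i f = 0 := by
  by_contra hne
  exact (totalDegree_le_of_dvd_of_isDomain h hne).not_gt (totalDegree_pderiv_lt hne)

variable [DecidableEq σ]

/-- The restriction of `f` to the line through `p` in direction `i`, as a polynomial in the `i`-th
coordinate. -/
def restrictLine (p : σ → R) (i : σ) (f : MvPolynomial σ R) : Polynomial R :=
  aeval (Function.update (fun j => Polynomial.C (p j)) i Polynomial.X) f

theorem eval_restrictLine (p : σ → R) (i : σ) (f : MvPolynomial σ R) (t : R) :
    (restrictLine p i f).eval t = eval (Function.update p i t) f := by
  induction f using MvPolynomial.induction_on with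
  | C c => simp [restrictLine]
  | add f g hf hg => simpa [restrictLine] using congrArg₂ (· + ·) hf hg
  | mul_X f j hf =>
    simp only [restrictLine, map_mul, Polynomial.eval_mul, aeval_X, eval_X] at hf ⊢
    rw [hf]
    rcases eq_or_ne j i with rfl | hj
    · simp
    · simp [hj]

theorem derivative_restrictLine (p : σ → R) (i : σ) (f : MvPolynomial σ R) :
    (restrictLine p i f).derivative = restrictLine p i (pderiv i f) := by
  induction f using MvPolynomial.induction_on with
  | C c => simp [restrictLine]
  | add f g hf hg => simpa [restrictLine] using congrArg₂ (· + ·) hf hg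
  | mul_X f j hf =>
    simp only [restrictLine] at hf ⊢
    simp only [pderiv_mul, map_mul, map_add, aeval_X, Polynomial.derivative_mul, hf]
    rcases eq_or_ne j i with rfl | hj
    · simp
    · simp [hj]

theorem natDegree_restrictLine_le (p : σ → R) (i : σ) (f : MvPolynomial σ R) :
    (restrictLine p i f).natDegree ≤ f.totalDegree := by
  refine (aeval_natDegree_le f le_rfl _ (n := 1) fun j => ?_).trans (mul_one _).le
  rcases eq_or_ne j i with rfl | hj
  · simpa using Polynomial.natDegree_X_le
  · simp [hj]

theorem eval_update_eq_of_pderiv_eq_zero [IsDomain R] [CharZero R] {i : σ}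
    {f : MvPolynomial σ R} (h : pderiv i f = 0) (p : σ → R) (t : R) :
    eval (Function.update p i t) f = eval p f := by
  have hder : (restrictLine p i f).derivative = 0 := by
    rw [derivative_restrictLine, h]
    simp [restrictLine]
  have hconst := Polynomial.eq_C_of_derivative_eq_zero hder
  conv_rhs => rw [← Function.update_eq_self i p]
  rw [← eval_restrictLine, ← eval_restrictLine, hconst, Polynomial.eval_C, Polynomial.eval_C]

end Restriction

theorem card_le_totalDegree_of_forall_ne {σ R : Type*} [CommRing R] [IsDomain R]
    {f : MvPolynomial σ R} {p : σ → R} {i : σ} (hp : eval p f ≠ 0) {S : Finset (σ → R)}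
    (hline : ∀ q ∈ S, ∀ j ≠ i, q j = p j) (hzero : ∀ q ∈ S, eval q f = 0) :
    S.card ≤ f.totalDegree := by
  classical
  have hupdate : ∀ q ∈ S, Function.update p i (q i) = q := fun q hq =>
    Function.update_eq_iff.mpr ⟨rfl, fun j hj => (hline q hq j hj).symm⟩
  have hinj : Set.InjOn (fun q : σ → R => q i) S := fun q hq q' hq' h => by
    rw [← hupdate q hq, ← hupdate q' hq']
    exact congrArg _ h
  have hne : restrictLine p i f ≠ 0 := fun h => hp <| by
    rw [← Function.update_eq_self i p, ← eval_restrictLine, h, Polynomial.eval_zero]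
  rw [← Finset.card_image_of_injOn hinj]
  refine (Polynomial.card_le_degree_of_subset_roots fun t ht => ?_).trans
    (natDegree_restrictLine_le p i f)
  obtain ⟨q, hq, rfl⟩ := Finset.mem_image.mp ht
  rw [Polynomial.mem_roots hne, Polynomial.IsRoot.def, eval_restrictLine, hupdate q hq,
    hzero q hq]

@[simp]
theorem mem_zeroSet_singleton {f : Poly2} {p : Plane} : p ∈ zeroSet {f} ↔ eval p f = 0 := by
  simp [zeroSet]

theorem zeroSet_singleton_mul (f g : Poly2) : zeroSet {f * g} = zeroSet {f} ∪ zeroSet {g} := by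
  ext p
  simp

theorem containsAxisParallelLine_iff {W : Set Plane} :
    ContainsAxisParallelLine W ↔ ∃ i a, {p : Plane | p i = a} ⊆ W := by
  rw [ContainsAxisParallelLine, or_comm, Fin.exists_fin_two]

theorem ContainsAxisParallelLine.mono {V W : Set Plane} (hVW : V ⊆ W)
    (hV : ContainsAxisParallelLine V) : ContainsAxisParallelLine W := by
  obtain ⟨i, a, h⟩ := containsAxisParallelLine_iff.mp hV
  exact containsAxisParallelLine_iff.mpr ⟨i, a, h.trans hVW⟩

theorem ne_zero_of_not_containsAxisParallelLine {f : Poly2}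
    (hf : ¬ContainsAxisParallelLine (zeroSet {f})) : f ≠ 0 := by
  rintro rfl
  exact hf (Or.inl ⟨0, fun p _ => by simp⟩)

theorem containsAxisParallelLine_of_pderiv_eq_zero {f : Poly2} {i : Fin 2} (h : pderiv i f = 0)
    {p : Plane} (hp : p ∈ zeroSet {f}) : ContainsAxisParallelLine (zeroSet {f}) := by
  obtain ⟨j, hj⟩ := exists_ne i
  refine containsAxisParallelLine_iff.mpr ⟨j, p j, fun q hq => ?_⟩
  have hqp : Function.update p i (q i) = q :=
    Function.update_eq_iff.mpr ⟨rfl, fun k hk => by rw [show k = j by lia]; exact hq.symm⟩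
  rw [mem_zeroSet_singleton, ← hqp, eval_update_eq_of_pderiv_eq_zero h]
  exact mem_zeroSet_singleton.mp hp

theorem card_le_card_mul_totalDegree {f : Poly2} (hf : ¬ContainsAxisParallelLine (zeroSet {f}))
    {i : Fin 2} {A : Finset ℝ} {S : Finset Plane} (hSA : ∀ p ∈ S, p i ∈ A)
    (hSf : ∀ p ∈ S, p ∈ zeroSet {f}) : S.card ≤ A.card * f.totalDegree := by
  rw [mul_comm]
  refine Finset.card_le_mul_card_image_of_maps_to hSA _ fun a _ => ?_
  obtain ⟨p, rfl, hp⟩ : ∃ p : Plane, p i = a ∧ eval p f ≠ 0 := by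
    by_contra! h
    exact hf (containsAxisParallelLine_iff.mpr ⟨i, a, fun p hp => by simpa using h p hp⟩)
  obtain ⟨j, hj⟩ := exists_ne i
  refine card_le_totalDegree_of_forall_ne (i := j) hp (fun q hq k hk => ?_) fun q hq => ?_
  · rw [show k = i by lia]
    exact (Finset.mem_filter.mp hq).2
  · exact mem_zeroSet_singleton.mp (hSf q (Finset.mem_filter.mp hq).1)

theorem zeroSet_ne_of_minimal {p k : Poly2} (hp : Irreducible p) (hk : k ≠ 0)
    (hmin : ∀ h : Poly2, zeroSet {h} = zeroSet {p * k} → (p * k).totalDegree ≤ h.totalDegree) :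
    zeroSet {k} ≠ zeroSet {p * k} := fun h => by
  have hdeg := hmin k h
  rw [totalDegree_mul_of_isDomain hp.ne_zero hk] at hdeg
  have hconst : p.totalDegree = 0 := by lia
  have hpC := totalDegree_eq_zero_iff_eq_C.mp hconst
  refine hp.not_isUnit (isUnit_iff_totalDegree_of_isReduced.mpr ⟨?_, hconst⟩)
  exact isUnit_iff_ne_zero.mpr fun h0 => hp.ne_zero (by rw [hpC, h0, C_0])

theorem exists_isRelPrime_pderiv {f : Poly2} (hf : ¬ContainsAxisParallelLine (zeroSet {f}))
    (i : Fin 2) : ∃ g : Poly2, zeroSet {g} = zeroSet {f} ∧ g.totalDegree ≤ f.totalDegree ∧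
      IsRelPrime g (pderiv i g) := by
  obtain ⟨g, hgf, hmin⟩ := exists_minimalFor_of_wellFoundedLT
    (fun g : Poly2 => zeroSet {g} = zeroSet {f}) totalDegree ⟨f, rfl⟩
  replace hmin (h : Poly2) (hh : zeroSet {h} = zeroSet {g}) : g.totalDegree ≤ h.totalDegree :=
    le_of_not_gt fun hlt => hlt.not_ge (hmin (hh.trans hgf) hlt.le)
  refine ⟨g, hgf, hmin f hgf.symm, ?_⟩
  rw [← hgf] at hf
  clear hgf
  have hg0 : g ≠ 0 := ne_zero_of_not_containsAxisParallelLine hf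
  refine WfDvdMonoid.isRelPrime_of_no_irreducible_factors (fun h => hg0 h.1) fun p hp hpg hpd => ?_
  obtain ⟨k, rfl⟩ := hpg
  have hne := zeroSet_ne_of_minimal hp (right_ne_zero_of_mul hg0) hmin
  rw [pderiv_mul, dvd_add_left (dvd_mul_right p _)] at hpd
  rcases hp.prime.dvd_or_dvd hpd with hpp | ⟨q, rfl⟩
  · obtain ⟨z, hz⟩ : (zeroSet {p}).Nonempty := by
      by_contra hempty
      rw [Set.not_nonempty_iff_eq_empty] at hempty
      exact hne (by rw [zeroSet_singleton_mul, hempty, Set.empty_union])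
    refine hf ((containsAxisParallelLine_of_pderiv_eq_zero (pderiv_eq_zero_of_dvd hpp) hz).mono ?_)
    rw [zeroSet_singleton_mul]
    exact Set.subset_union_left
  · exact hne (by simp only [zeroSet_singleton_mul, ← Set.union_assoc, Set.union_self])

section Critical

variable {σ : Type*} [DecidableEq σ] {f : MvPolynomial σ ℝ} {p : σ → ℝ} {i : σ}

theorem continuous_eval_update (f : MvPolynomial σ ℝ) (p : σ → ℝ) (i : σ) :
    Continuous fun t => eval (Function.update p i t) f :=
  f.continuous_eval.comp (continuous_const.update i continuous_id)

theorem exists_sign_change (hp : eval p f = 0) (hd : 0 < eval p (pderiv i f)) {a b : ℝ}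
    (ha : a < p i) (hb : p i < b) :
    ∃ u ∈ Set.Ioo a (p i), ∃ v ∈ Set.Ioo (p i) b,
      eval (Function.update p i u) f < 0 ∧ 0 < eval (Function.update p i v) f := by
  have hderiv : 0 < deriv (fun t => (restrictLine p i f).eval t) (p i) := by
    rw [Polynomial.deriv, derivative_restrictLine, eval_restrictLine, Function.update_eq_self]
    exact hd
  have hsign := (eventually_nhdsWithin_sign_eq_of_deriv_pos hderiv
    (by rwa [eval_restrictLine, Function.update_eq_self]))
  obtain ⟨u, hu, hau⟩ := ((hsign.filter_mono nhdsWithin_le_nhds).and (Ioo_mem_nhdsLT ha)).exists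
  obtain ⟨v, hv, hvb⟩ := ((hsign.filter_mono nhdsWithin_le_nhds).and (Ioo_mem_nhdsGT hb)).exists
  rw [eval_restrictLine] at hu hv
  rw [sign_neg (sub_neg.mpr hau.2), sign_eq_neg_one_iff] at hu
  rw [sign_pos (sub_pos.mpr hvb.1), sign_eq_one_iff] at hv
  exact ⟨u, hau, v, hvb, hu, hv⟩

theorem exists_zero_gt {i j : σ} (hij : i ≠ j) (hp : eval p f = 0) (hd : eval p (pderiv i f) ≠ 0)
    {a b c : ℝ} (ha : a < p i) (hb : p i < b) (hc : p j < c) :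
    ∃ s ∈ Set.Ioo a b, ∃ t ∈ Set.Ioo (p j) c,
      eval (Function.update (Function.update p i s) j t) f = 0 := by
  wlog hpos : 0 < eval p (pderiv i f) generalizing f
  · obtain ⟨s, hs, t, ht, hst⟩ := this (f := -f) (by simpa using hp) (by simpa using hd)
      (by simpa using lt_of_le_of_ne (not_lt.mp hpos) hd)
    exact ⟨s, hs, t, ht, by simpa using hst⟩
  -- The sign change along the `i`-th coordinate line through `p` persists on nearby parallel lines.
  obtain ⟨u, hu, v, hv, hfu, hfv⟩ := exists_sign_change hp hpos ha hb
  have hnear (s : ℝ) : Filter.Tendsto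
      (fun t => eval (Function.update (Function.update p i s) j t) f)
      (nhdsWithin (p j) (Set.Ioi (p j))) (nhds (eval (Function.update p i s) f)) := by
    have hcont := (continuous_eval_update f (Function.update p i s) j).tendsto (p j)
    rw [Function.update_comm hij, Function.update_eq_self] at hcont
    exact hcont.mono_left nhdsWithin_le_nhds
  obtain ⟨t, htu, htv, ht⟩ := (((hnear u).eventually_lt_const hfu).and
    (((hnear v).eventually_const_lt hfv).and (Ioo_mem_nhdsGT hc))).exists
  simp only [Function.update_comm hij] at htu htv ⊢
  obtain ⟨s, hs, hs0⟩ := intermediate_value_Icc (hu.2.trans hv.1).le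
    (continuous_eval_update f (Function.update p j t) i).continuousOn ⟨htu.le, htv.le⟩
  exact ⟨s, ⟨hu.1.trans_le hs.1, hs.2.trans_lt hv.2⟩, t, ht, hs0⟩

end Critical

theorem exists_zero_boundary_or_critical {f : Poly2} {lo hi p : Plane} (hp : p ∈ Set.Icc lo hi)
    (hpf : eval p f = 0) : ∃ q ∈ Set.Icc lo hi, eval q f = 0 ∧
      ((∃ i, q i = lo i ∨ q i = hi i) ∨ eval q (pderiv 1 f) = 0) := by
  have hcompact : IsCompact (Set.Icc lo hi ∩ {q | eval q f = 0}) :=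
    isCompact_Icc.inter_right (isClosed_eq f.continuous_eval continuous_const)
  obtain ⟨q, ⟨hq, hqf⟩, hmax⟩ :=
    hcompact.exists_isMaxOn ⟨p, hp, hpf⟩ (continuous_apply 0).continuousOn
  refine ⟨q, hq, hqf, ?_⟩
  by_contra! h
  obtain ⟨hbd, hcrit⟩ := h
  have hlo (i : Fin 2) : lo i < q i := (hq.1 i).lt_of_ne' (hbd i).1
  have hhi (i : Fin 2) : q i < hi i := (hq.2 i).lt_of_ne (hbd i).2
  obtain ⟨s, hs, t, ht, hst⟩ :=
    exists_zero_gt one_ne_zero hqf hcrit (hlo 1) (hhi 1) (hhi 0)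
  have hmem : Function.update (Function.update q 1 s) 0 t ∈ Set.Icc lo hi :=
    ⟨Fin.forall_fin_two.mpr ⟨by simpa using ((hlo 0).trans ht.1).le, by simpa using hs.1.le⟩,
      Fin.forall_fin_two.mpr ⟨by simpa using ht.2.le, by simpa using hs.2.le⟩⟩
  have hle := hmax ⟨hmem, hst⟩
  simp only [Set.mem_ofPred_eq, Function.update_self] at hle
  exact hle.not_gt ht.1

theorem eq_of_mem_Icc_of_mem_Icc {α : Type*} [PartialOrder α] {x : ℕ → α} (hx : Monotone x)
    {t : α} {m n : ℕ} (hm : x m < x (m + 1)) (hn : x n < x (n + 1))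
    (htm : t ∈ Set.Icc (x m) (x (m + 1))) (htn : t ∈ Set.Icc (x n) (x (n + 1)))
    (h : t = x m ↔ t = x n) : m = n := by
  wlog hlt : m < n generalizing m n
  · by_contra hne
    exact hne (this hn hm htn htm h.symm (by lia)).symm
  have hle : x (m + 1) ≤ x n := hx hlt
  have htm' : t = x m := h.mpr (le_antisymm (htm.2.trans hle) htn.1)
  exact absurd (hm.trans_le (hle.trans htn.1)) htm'.not_gt

theorem card_cells_le {ι α : Type*} [Fintype ι] [PartialOrder α] {X : ι → ℕ → α}
    (hX : ∀ i, Monotone (X i)) {T : Finset (ι → ℕ)} (hT : ∀ c ∈ T, ∀ i, X i (c i) < X i (c i + 1))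
    {Q : Finset (ι → α)}
    (hQ : ∀ c ∈ T, ∃ q ∈ Q, q ∈ Set.Icc (fun i => X i (c i)) fun i => X i (c i + 1)) :
    T.card ≤ 2 ^ Fintype.card ι * Q.card := by
  classical
  obtain rfl | ⟨c₀, hc₀⟩ := T.eq_empty_or_nonempty
  · simp
  have : Nonempty (ι → α) := ⟨(hQ c₀ hc₀).choose⟩
  choose! q hqQ hq using hQ
  -- Closed cells sharing a point `t` are told apart by the `i` for which `t i` is a left endpoint.
  have hinj : Set.InjOn (fun c => (q c, fun i => decide (q c i = X i (c i))))
      (T : Set (ι → ℕ)) := by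
    intro c hc c' hc' h
    obtain ⟨hqq, hside⟩ := Prod.ext_iff.mp h
    dsimp only at hqq hside
    refine funext fun i => eq_of_mem_Icc_of_mem_Icc (hX i) (hT c hc i) (hT c' hc' i)
      ⟨(hq c hc).1 i, (hq c hc).2 i⟩ ?_ ?_
    · rw [hqq]
      exact ⟨(hq c' hc').1 i, (hq c' hc').2 i⟩
    · conv_rhs => rw [hqq]
      exact decide_eq_decide.mp (congrFun hside i)
  calc T.card ≤ (Q ×ˢ (Finset.univ : Finset (ι → Bool))).card :=
        Finset.card_le_card_of_injOn _
          (fun c hc => Finset.mem_product.mpr ⟨hqQ c hc, Finset.mem_univ _⟩) hinj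
    _ = 2 ^ Fintype.card ι * Q.card := by
        simp [Finset.card_product, mul_comm]

theorem card_critical_le {g : Poly2} {i : Fin 2} (hg : IsRelPrime g (pderiv i g))
    {S : Finset Plane} (hSg : ∀ p ∈ S, eval p g = 0) (hS : ∀ p ∈ S, eval p (pderiv i g) = 0) :
    S.card ≤ g.totalDegree ^ 2 := by
  rcases eq_or_ne (pderiv i g) 0 with h0 | h0
  · rw [h0, isRelPrime_zero_right] at hg
    rw [Finset.card_eq_zero.mpr (Finset.eq_empty_of_forall_notMem fun p hp =>
      ((hg.map (eval p)).ne_zero (hSg p hp)))]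
    exact Nat.zero_le _
  · calc S.card ≤ g.totalDegree * (pderiv i g).totalDegree :=
          card_le_totalDegree_mul_totalDegree h0 hg hSg hS
      _ ≤ g.totalDegree ^ 2 := by
          rw [sq]
          exact Nat.mul_le_mul_left _ (totalDegree_pderiv_lt h0).le

theorem card_boundary_or_critical_le {g : Poly2} (hg : ¬ContainsAxisParallelLine (zeroSet {g}))
    (hrel : IsRelPrime g (pderiv 1 g)) {G : Fin 2 → Finset ℝ} {Q : Finset Plane}
    (hQg : ∀ q ∈ Q, eval q g = 0)
    (hQ : ∀ q ∈ Q, (∃ i, q i ∈ G i) ∨ eval q (pderiv 1 g) = 0) :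
    Q.card ≤ (∑ i, (G i).card) * g.totalDegree + g.totalDegree ^ 2 := by
  classical
  have hcover : Q ⊆ (Finset.univ.biUnion fun i => {q ∈ Q | q i ∈ G i}) ∪
      {q ∈ Q | eval q (pderiv 1 g) = 0} := fun q hq => by
    simpa [hq] using hQ q hq
  refine (Finset.card_le_card hcover).trans ((Finset.card_union_le _ _).trans
    (add_le_add (Finset.card_biUnion_le.trans ?_) (card_critical_le hrel ?_ ?_)))
  · rw [Finset.sum_mul]
    refine Finset.sum_le_sum fun i _ => card_le_card_mul_totalDegree hg
      (fun q hq => (Finset.mem_filter.mp hq).2) fun q hq => ?_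
    exact mem_zeroSet_singleton.mpr (hQg q (Finset.mem_filter.mp hq).1)
  · exact fun q hq => hQg q (Finset.mem_filter.mp hq).1
  · exact fun q hq => (Finset.mem_filter.mp hq).2

theorem card_cells_meeting_zeroSet_le {f : Poly2} (hf : ¬ContainsAxisParallelLine (zeroSet {f}))
    {r : ℕ} {X : Fin 2 → ℕ → ℝ} (hX : ∀ i, Monotone (X i)) {T : Finset (Fin 2 → ℕ)}
    (hTr : ∀ c ∈ T, ∀ i, c i < r) (hT : ∀ c ∈ T, ∀ i, X i (c i) < X i (c i + 1))
    (hTf : ∀ c ∈ T, (Set.Icc (fun i => X i (c i)) (fun i => X i (c i + 1)) ∩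
      zeroSet {f}).Nonempty) :
    T.card ≤ 4 * (2 * (r + 1) * f.totalDegree + f.totalDegree ^ 2) := by
  classical
  obtain ⟨g, hgf, hdeg, hrel⟩ := exists_isRelPrime_pderiv hf 1
  rw [← hgf] at hf hTf
  have hbox (c) (hc : c ∈ T) := exists_zero_boundary_or_critical (hTf c hc).choose_spec.1
    (mem_zeroSet_singleton.mp (hTf c hc).choose_spec.2)
  choose! q hq hqg hqcase using hbox
  let G : Fin 2 → Finset ℝ := fun i => (Finset.range (r + 1)).image (X i)
  have hcard : (T.image q).card ≤ (∑ i, (G i).card) * g.totalDegree + g.totalDegree ^ 2 := by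
    refine card_boundary_or_critical_le hf hrel (Finset.forall_mem_image.mpr hqg)
      (Finset.forall_mem_image.mpr fun c hc => (hqcase c hc).imp_left ?_)
    have hgrid (i : Fin 2) (n : ℕ) (hn : n ≤ r) : X i n ∈ G i :=
      Finset.mem_image_of_mem _ (Finset.mem_range_succ_iff.mpr hn)
    rintro ⟨i, hi | hi⟩
    · exact ⟨i, hi ▸ hgrid i _ (hTr c hc i).le⟩
    · exact ⟨i, hi ▸ hgrid i _ (hTr c hc i)⟩
  have hG : ∑ i, (G i).card ≤ 2 * (r + 1) := by
    rw [Fin.sum_univ_two, two_mul]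
    refine add_le_add ?_ ?_ <;> exact Finset.card_image_le.trans (Finset.card_range _).le
  calc T.card ≤ 4 * (T.image q).card := card_cells_le hX hT fun c hc =>
        ⟨q c, Finset.mem_image_of_mem q hc, hq c hc⟩
    _ ≤ 4 * (2 * (r + 1) * f.totalDegree + f.totalDegree ^ 2) := by
        refine Nat.mul_le_mul_left _ (hcard.trans ?_)
        gcongr

section Partition

variable {α : Type*} [LinearOrder α] [NoMaxOrder α] [Nonempty α]

theorem exists_card_filter_lt_eq (A : Finset α) {m : ℕ} (hm : m ≤ A.card) :
    ∃ x, (A.filter (· < x)).card = m := by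
  induction A using Finset.induction_on_max generalizing m with
  | empty =>
    rw [Finset.card_empty, Nat.le_zero] at hm
    exact ⟨Classical.arbitrary α, by simp [hm]⟩
  | insert a A hA ih =>
    have ha : a ∉ A := fun h => (hA a h).false
    rw [Finset.card_insert_of_notMem ha] at hm
    rcases hm.lt_or_eq with hm | rfl
    · obtain ⟨x, hx⟩ := ih (Nat.le_of_lt_succ hm)
      refine ⟨min x a, ?_⟩
      rw [Finset.filter_insert, if_neg (min_le_right x a).not_gt, ← hx]
      exact congrArg _ (Finset.filter_congr fun b hb => by simp [hA b hb])
    · obtain ⟨x, hx⟩ := exists_gt a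
      refine ⟨x, ?_⟩
      rw [Finset.filter_true_of_mem, Finset.card_insert_of_notMem ha]
      exact Finset.forall_mem_insert _ _ _ |>.mpr ⟨hx, fun b hb => (hA b hb).trans hx⟩

theorem exists_monotone_card_filter_lt (A : Finset α) :
    ∃ X : ℕ → α, Monotone X ∧ ∀ n, (A.filter (· < X n)).card = min n A.card := by
  choose! x hx using fun m (hm : m ≤ A.card) => exists_card_filter_lt_eq A hm
  have hcard (n : ℕ) := hx (min n A.card) (min_le_right _ _)
  refine ⟨fun n => x (min n A.card), fun m n hmn => ?_, hcard⟩
  rcases (min_le_min_right A.card hmn).eq_or_lt with heq | hlt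
  · simp only [heq, le_refl]
  · by_contra! hnm
    have hle : (A.filter (· < x (min n A.card))).card ≤ (A.filter (· < x (min m A.card))).card :=
      Finset.card_le_card (Finset.monotone_filter_right A fun a _ ha => lt_trans ha hnm)
    rw [hcard, hcard] at hle
    exact hle.not_gt hlt

theorem exists_partition (A : Finset α) {r k : ℕ} (hA : A.card ≤ r * k) :
    ∃ X : ℕ → α, Monotone X ∧ (∀ a ∈ A, ∃ n < r, a ∈ Set.Ico (X n) (X (n + 1))) ∧
      ∀ n, (A.filter (· ∈ Set.Ico (X n) (X (n + 1)))).card ≤ k := by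
  obtain ⟨X, hX, hcard⟩ := exists_monotone_card_filter_lt A
  have hmono : Monotone fun n => X (n * k) := fun m n hmn => hX (Nat.mul_le_mul_right k hmn)
  refine ⟨_, hmono, fun a ha => ?_, fun n => ?_⟩
  · have hfirst : X (0 * k) ≤ a := not_lt.mp (Finset.filter_eq_empty_iff.mp
      (Finset.card_eq_zero.mp ((hcard _).trans (by simp))) ha)
    have hlast : a < X (r * k) := Finset.card_filter_eq_iff.mp
      ((hcard _).trans (min_eq_right hA)) a ha
    obtain ⟨n, hn, han⟩ := Set.mem_iUnion₂.mp
      (Ico_subset_biUnion_Ico r (fun n => X (n * k)) ⟨hfirst, hlast⟩)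
    exact ⟨n, Finset.mem_range.mp hn, han⟩
  · have hsplit : A.filter (· < X ((n + 1) * k)) =
        A.filter (· < X (n * k)) ∪ A.filter (· ∈ Set.Ico (X (n * k)) (X ((n + 1) * k))) := by
      ext a
      have := @hmono n (n + 1) n.le_succ
      grind
    have hdisj : Disjoint (A.filter (· < X (n * k)))
        (A.filter (· ∈ Set.Ico (X (n * k)) (X ((n + 1) * k)))) :=
      Finset.disjoint_filter.mpr fun a _ ha ha' => ha.not_ge ha'.1
    have hsum := congrArg Finset.card hsplit
    rw [Finset.card_union_of_disjoint hdisj, hcard, hcard] at hsum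
    rw [add_one_mul] at hsum ⊢
    lia

theorem exists_block_size {r n : ℕ} (hr : 0 < r) (hrn : r ≤ n) :
    ∃ k, n ≤ r * k ∧ r * k ≤ 2 * n := by
  refine ⟨n / r + 1, (Nat.lt_mul_div_succ n hr).le, ?_⟩
  have := Nat.mul_div_le n r
  rw [mul_add_one]
  lia

end Partition

section DoubleCounting

variable {α γ κ : Type*}

open Classical in
/-- The number of incidences between `P` and the sets `Z c`, `c ∈ C`, counted with the
multiplicity of `c ↦ Z c`. -/
def incidenceCount (P : Finset α) (C : Finset γ) (Z : γ → Set α) : ℕ :=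
  ∑ c ∈ C, (P.filter (· ∈ Z c)).card

open Classical in
/-- Any two distinct points of `P` lie in `Z c` for at most `M` indices `c ∈ C`. For `Z = id` this
is `AtMostThroughTwo`. -/
def PairMultiplicityLE (P : Finset α) (C : Finset γ) (Z : γ → Set α) (M : ℕ) : Prop :=
  ∀ p ∈ P, ∀ q ∈ P, p ≠ q → (C.filter fun c => p ∈ Z c ∧ q ∈ Z c).card ≤ M

theorem PairMultiplicityLE.mono {P : Finset α} {C : Finset γ} {Z Z' : γ → Set α} {M : ℕ}
    (h : PairMultiplicityLE P C Z M) (hZ : ∀ c ∈ C, Z' c ⊆ Z c) : PairMultiplicityLE P C Z' M := by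
  classical
  intro p hp q hq hpq
  exact (Finset.card_le_card (Finset.monotone_filter_right C fun c hc hpq =>
    ⟨hZ c hc hpq.1, hZ c hc hpq.2⟩)).trans (h p hp q hq hpq)

theorem incidenceCount_le_add {P : Finset α} {C : Finset γ} {Z Z₁ Z₂ : γ → Set α}
    (hZ : ∀ c ∈ C, Z c ⊆ Z₁ c ∪ Z₂ c) :
    incidenceCount P C Z ≤ incidenceCount P C Z₁ + incidenceCount P C Z₂ := by
  classical
  rw [incidenceCount, incidenceCount, incidenceCount, ← Finset.sum_add_distrib]
  refine Finset.sum_le_sum fun c hc => (Finset.card_le_card ?_).trans (Finset.card_union_le _ _)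
  rw [← Finset.filter_or]
  exact Finset.monotone_filter_right P fun p _ hp => hZ c hc hp

open Classical in
theorem incidenceCount_le_card_mul {P : Finset α} {C : Finset γ} {Z : γ → Set α} {v : ℕ}
    (hv : ∀ c ∈ C, (P.filter (· ∈ Z c)).card ≤ v) : incidenceCount P C Z ≤ C.card * v :=
  Finset.sum_le_card_nsmul C _ v hv

open Classical in
theorem PairMultiplicityLE.sum_card_le {P : Finset α} {C : Finset γ} {Z : γ → Set α} {M : ℕ}
    (h : PairMultiplicityLE P C Z M) {W : Finset (α × α)} (hW : W ⊆ P.offDiag) :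
    ∑ c ∈ C, (W.filter fun x => x.1 ∈ Z c ∧ x.2 ∈ Z c).card ≤ W.card * M := by
  have hcount := Finset.sum_card_bipartiteAbove_eq_sum_card_bipartiteBelow (s := C) (t := W)
    (fun c x => x.1 ∈ Z c ∧ x.2 ∈ Z c)
  simp only [Finset.bipartiteAbove, Finset.bipartiteBelow] at hcount
  rw [hcount]
  refine Finset.sum_le_card_nsmul W _ M fun x hx => ?_
  obtain ⟨hx₁, hx₂, hne⟩ := Finset.mem_offDiag.mp (hW hx)
  exact h _ hx₁ _ hx₂ hne

theorem card_le_card_image_add_card_offDiag [DecidableEq κ] (S : Finset α) (cell : α → κ) :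
    S.card ≤ (S.image cell).card + (S.offDiag.filter fun x => cell x.1 = cell x.2).card := by
  classical
  obtain ⟨T, hTS, hinj, himage⟩ := Finset.exists_subset_injOn_image_eq_of_surjOn (S : Set α)
    (S.image cell) (by simpa using Set.surjOn_image cell (S : Set α))
  rw [← himage, Finset.card_image_of_injOn hinj, ← Finset.card_sdiff_add_card_eq_card hTS,
    add_comm]
  refine Nat.add_le_add_left ((Finset.card_le_card fun p hp => ?_).trans
    (Finset.card_image_le (f := Prod.fst))) _
  obtain ⟨hpS, hpT⟩ := Finset.mem_sdiff.mp hp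
  obtain ⟨q, hq, hqp⟩ := Finset.mem_image.mp (himage ▸ Finset.mem_image_of_mem cell hpS)
  refine Finset.mem_image.mpr ⟨(p, q), Finset.mem_filter.mpr ⟨?_, hqp.symm⟩, rfl⟩
  exact Finset.mem_offDiag.mpr ⟨hpS, hTS hq, fun h : p = q => hpT (h ▸ hq)⟩

open Classical in
theorem PairMultiplicityLE.incidenceCount_le [DecidableEq κ] {P : Finset α} {C : Finset γ}
    {Z : γ → Set α} {M : ℕ} (h : PairMultiplicityLE P C Z M) (cell : α → κ) {v k : ℕ}
    (hv : ∀ c ∈ C, ((P.filter (· ∈ Z c)).image cell).card ≤ v)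
    (hk : ∀ p ∈ P, (P.filter fun q => cell p = cell q).card ≤ k) :
    incidenceCount P C Z ≤ C.card * v + P.card * k * M := by
  let W : Finset (α × α) := P.offDiag.filter fun x => cell x.1 = cell x.2
  have hW : W.card ≤ P.card * k := by
    have hmaps : ∀ x ∈ W, x.1 ∈ P := fun x hx =>
      (Finset.mem_offDiag.mp (Finset.mem_filter.mp hx).1).1
    rw [mul_comm]
    refine Finset.card_le_mul_card_image_of_maps_to hmaps k fun p hp => (?_ : _ ≤ _).trans (hk p hp)
    refine Finset.card_le_card_of_injOn Prod.snd (fun x hx => ?_) fun x hx y hy hxy => ?_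
    · simp only [W, Finset.coe_filter, Finset.mem_filter, Finset.mem_offDiag,
        Set.mem_ofPred_eq] at hx ⊢
      exact ⟨hx.1.1.2.1, hx.2 ▸ hx.1.2⟩
    · exact Prod.ext (((Finset.mem_filter.mp hx).2).trans (Finset.mem_filter.mp hy).2.symm) hxy
  calc incidenceCount P C Z
      ≤ ∑ c ∈ C, (v + (W.filter fun x => x.1 ∈ Z c ∧ x.2 ∈ Z c).card) := by
        refine Finset.sum_le_sum fun c hc =>
          (card_le_card_image_add_card_offDiag _ cell).trans (add_le_add (hv c hc) ?_)
        refine Finset.card_le_card fun x hx => ?_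
        simp only [W, Finset.mem_filter, Finset.mem_offDiag] at hx ⊢
        tauto
    _ = C.card * v + ∑ c ∈ C, (W.filter fun x => x.1 ∈ Z c ∧ x.2 ∈ Z c).card := by
        rw [Finset.sum_add_distrib, Finset.sum_const, smul_eq_mul]
    _ ≤ C.card * v + P.card * k * M := by
        gcongr
        exact (h.sum_card_le (Finset.filter_subset _ _)).trans (Nat.mul_le_mul_right M hW)

end DoubleCounting

theorem exists_cells {ι α : Type*} [Fintype ι] [DecidableEq ι] [LinearOrder α] [NoMaxOrder α]
    [Nonempty α] (G : ι → Finset α) {r : ℕ} (hr : 0 < r) (hG : ∀ i, r ≤ (G i).card) :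
    ∃ (X : ι → ℕ → α) (cell : (ι → α) → ι → ℕ) (k : ℕ), (∀ i, Monotone (X i)) ∧
      (∀ p ∈ Fintype.piFinset G, ∀ i,
        cell p i < r ∧ p i ∈ Set.Ico (X i (cell p i)) (X i (cell p i + 1))) ∧
      (∀ c, ((Fintype.piFinset G).filter fun q => c = cell q).card ≤ k) ∧
      r ^ Fintype.card ι * k ≤ 2 ^ Fintype.card ι * (Fintype.piFinset G).card := by
  choose k hGk hk using fun i => exists_block_size hr (hG i)
  choose X hX hcover hcard using fun i => exists_partition (G i) (hGk i)
  choose! n hn using hcover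
  refine ⟨X, fun p i => n i (p i), ∏ i, k i, hX, fun p hp i => ?_, fun c => ?_, ?_⟩
  · exact hn i (p i) (Fintype.mem_piFinset.mp hp i)
  · have hsub : ((Fintype.piFinset G).filter fun q => c = fun i => n i (q i)) ⊆
        Fintype.piFinset fun i => (G i).filter (· ∈ Set.Ico (X i (c i)) (X i (c i + 1))) := by
      intro q hq
      obtain ⟨hqG, rfl⟩ := Finset.mem_filter.mp hq
      refine Fintype.mem_piFinset.mpr fun i => ?_
      have hqi := Fintype.mem_piFinset.mp hqG i
      exact Finset.mem_filter.mpr ⟨hqi, (hn i _ hqi).2⟩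
    refine (Finset.card_le_card hsub).trans ?_
    rw [Fintype.card_piFinset]
    exact Finset.prod_le_prod' fun i _ => hcard i (c i)
  · have hprod := Finset.prod_le_prod' fun i (_ : i ∈ Finset.univ) => hk i
    simpa only [Finset.prod_mul_distrib, Finset.prod_const, Finset.card_univ,
      Fintype.card_piFinset] using hprod

theorem sq_mul_incidenceCount_le {γ : Type*} {C : Finset γ} {F : γ → Poly2}
    {G : Fin 2 → Finset ℝ} {d M r : ℕ}
    (hF : ∀ c ∈ C, ¬ContainsAxisParallelLine (zeroSet {F c})) (hd : ∀ c ∈ C, (F c).totalDegree ≤ d)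
    (hM : PairMultiplicityLE (Fintype.piFinset G) C (fun c => zeroSet {F c}) M)
    (hr : 0 < r) (hG : ∀ i, r ≤ (G i).card) :
    r ^ 2 * incidenceCount (Fintype.piFinset G) C (fun c => zeroSet {F c}) ≤
      r ^ 2 * (C.card * (16 * r * d + 4 * d ^ 2)) + 4 * M * (Fintype.piFinset G).card ^ 2 := by
  classical
  obtain ⟨X, cell, k, hX, hcell, hk, hrk⟩ := exists_cells G hr hG
  rw [Fintype.card_fin] at hrk
  have hv (c) (hc : c ∈ C) : (((Fintype.piFinset G).filter (· ∈ zeroSet {F c})).image cell).card ≤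
      16 * r * d + 4 * d ^ 2 := by
    have hmem (p) (hp : p ∈ (Fintype.piFinset G).filter (· ∈ zeroSet {F c})) :=
      hcell p (Finset.mem_filter.mp hp).1
    refine (card_cells_meeting_zeroSet_le (hF c hc) hX
      (Finset.forall_mem_image.mpr fun p hp i => (hmem p hp i).1)
      (Finset.forall_mem_image.mpr fun p hp i => (hmem p hp i).2.1.trans_lt (hmem p hp i).2.2)
      (Finset.forall_mem_image.mpr fun p hp => ⟨p, ⟨fun i => (hmem p hp i).2.1,
        fun i => (hmem p hp i).2.2.le⟩, (Finset.mem_filter.mp hp).2⟩)).trans ?_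
    have := hd c hc
    calc 4 * (2 * (r + 1) * (F c).totalDegree + (F c).totalDegree ^ 2)
        ≤ 4 * (2 * (r + r) * d + d ^ 2) := by gcongr; exact hr
      _ = 16 * r * d + 4 * d ^ 2 := by ring
  calc _ ≤ r ^ 2 * (C.card * (16 * r * d + 4 * d ^ 2) + (Fintype.piFinset G).card * k * M) :=
        Nat.mul_le_mul_left _ (hM.incidenceCount_le cell hv fun p _ => hk (cell p))
    _ = r ^ 2 * (C.card * (16 * r * d + 4 * d ^ 2)) +
        r ^ 2 * k * (M * (Fintype.piFinset G).card) := by ring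
    _ ≤ r ^ 2 * (C.card * (16 * r * d + 4 * d ^ 2)) +
        2 ^ 2 * (Fintype.piFinset G).card * (M * (Fintype.piFinset G).card) := by gcongr
    _ = _ := by ring

/-- The main term `d^(2/3) M^(1/3) P^(2/3) N^(2/3)` of the incidence bounds, for `N` curves of
degree at most `d` and `P` points. -/
def mainTerm (d M P N : ℝ) : ℝ :=
  d ^ (2 / 3 : ℝ) * M ^ (1 / 3 : ℝ) * P ^ (2 / 3 : ℝ) * N ^ (2 / 3 : ℝ)

theorem mainTerm_nonneg {d M P N : ℝ} (hd : 0 ≤ d) (hM : 0 ≤ M) (hP : 0 ≤ P) (hN : 0 ≤ N) :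
    0 ≤ mainTerm d M P N := by
  unfold mainTerm; positivity

theorem rpow_div_three_pow_three {x : ℝ} (hx : 0 ≤ x) (k : ℕ) : (x ^ (k / 3 : ℝ)) ^ 3 = x ^ k := by
  rw [← Real.rpow_mul_natCast hx, Nat.cast_ofNat, div_mul_cancel₀ _ three_ne_zero,
    Real.rpow_natCast]

theorem mainTerm_pow_three {d M P N : ℝ} (hd : 0 ≤ d) (hM : 0 ≤ M) (hP : 0 ≤ P) (hN : 0 ≤ N) :
    mainTerm d M P N ^ 3 = d ^ 2 * M * P ^ 2 * N ^ 2 := by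
  have hd' := rpow_div_three_pow_three hd 2
  have hM' := rpow_div_three_pow_three hM 1
  have hP' := rpow_div_three_pow_three hP 2
  have hN' := rpow_div_three_pow_three hN 2
  push_cast at hd' hM' hP' hN'
  rw [mainTerm, mul_pow, mul_pow, mul_pow, hd', hM', hP', hN', pow_one]

theorem mainTerm_le_mainTerm {d M P P' N : ℝ} (hd : 0 ≤ d) (hM : 0 ≤ M) (hP : 0 ≤ P) (hN : 0 ≤ N)
    (h : P ≤ P') : mainTerm d M P N ≤ mainTerm d M P' N := by
  unfold mainTerm; gcongr

theorem le_mainTerm_of_pow_three_le {d M P N x : ℝ} (hd : 0 ≤ d) (hM : 0 ≤ M) (hP : 0 ≤ P)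
    (hN : 0 ≤ N) (h : x ^ 3 ≤ d ^ 2 * M * P ^ 2 * N ^ 2) : x ≤ mainTerm d M P N :=
  le_of_pow_le_pow_left₀ three_ne_zero (mainTerm_nonneg hd hM hP hN)
    (h.trans (mainTerm_pow_three hd hM hP hN).ge)

theorem mainTerm_add_le_two_mul_mainTerm {d M P N : ℝ} (hd : 0 ≤ d) (hM : 0 ≤ M) (hP : 0 ≤ P)
    (hN : 0 ≤ N) (h : d ^ 4 * N ≤ M * P ^ 2) :
    mainTerm d M P N + d ^ 2 * N ≤ 2 * mainTerm d M P N := by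
  rw [two_mul]
  refine add_le_add_right (le_mainTerm_of_pow_three_le hd hM hP hN ?_) _
  calc (d ^ 2 * N) ^ 3 = d ^ 2 * N ^ 2 * (d ^ 4 * N) := by ring
    _ ≤ d ^ 2 * N ^ 2 * (M * P ^ 2) := by gcongr
    _ = d ^ 2 * M * P ^ 2 * N ^ 2 := by ring

theorem mul_le_mainTerm {d M n N L : ℝ} (hd : 0 ≤ d) (hM : 0 ≤ M) (hn : 0 ≤ n) (hN : 0 ≤ N)
    (hL : 0 ≤ L) (hLd : L ≤ N * d) (hLM : L ≤ n * M) : n * L ≤ mainTerm d M (n ^ 2) N := by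
  refine le_mainTerm_of_pow_three_le hd hM (by positivity) hN ?_
  calc (n * L) ^ 3 = n ^ 3 * (L ^ 2 * L) := by ring
    _ ≤ n ^ 3 * ((N * d) ^ 2 * (n * M)) := by gcongr
    _ = d ^ 2 * M * (n ^ 2) ^ 2 * N ^ 2 := by ring

theorem exists_balance {d M P N : ℝ} (hd : 0 < d) (hM : 0 ≤ M) (hP : 0 ≤ P) (hN : 0 < N) :
    ∃ ρ, 0 ≤ ρ ∧ ρ * (N * d) = mainTerm d M P N ∧ M * P ^ 2 = ρ ^ 2 * mainTerm d M P N := by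
  have hT := mainTerm_nonneg hd.le hM hP hN.le
  have hNd : 0 < N * d := mul_pos hN hd
  obtain ⟨ρ, hρ⟩ : ∃ ρ, ρ * (N * d) = mainTerm d M P N := ⟨_, div_mul_cancel₀ _ hNd.ne'⟩
  refine ⟨ρ, nonneg_of_mul_nonneg_left (hρ ▸ hT) hNd, hρ, ?_⟩
  refine mul_left_cancel₀ (pow_ne_zero 2 hNd.ne') ?_
  calc (N * d) ^ 2 * (M * P ^ 2) = mainTerm d M P N ^ 3 := by
        rw [mainTerm_pow_three hd.le hM hP hN.le]; ring
    _ = (N * d) ^ 2 * (ρ ^ 2 * mainTerm d M P N) := by rw [← hρ]; ring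

theorem le_mainTerm_add_of_cell_bound {d M P N m I : ℕ} (hm : I ≤ N * (m * d))
    (hcell : ∀ r, 0 < r → r ≤ m → r ^ 2 * I ≤ r ^ 2 * (N * (16 * r * d + 4 * d ^ 2)) +
      4 * M * P ^ 2) :
    (I : ℝ) ≤ 20 * (mainTerm d M P N + d ^ 2 * N) := by
  have hT : 0 ≤ mainTerm d M P N := mainTerm_nonneg d.cast_nonneg M.cast_nonneg P.cast_nonneg
    N.cast_nonneg
  rcases Nat.eq_zero_or_pos (N * d) with hNd | hNd
  · have hI : I = 0 := by rwa [mul_left_comm, hNd, mul_zero, Nat.le_zero] at hm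
    rw [hI, Nat.cast_zero]
    positivity
  have hd : (1 : ℝ) ≤ d := by exact_mod_cast Nat.pos_of_mul_pos_left hNd
  have hN : (0 : ℝ) < N := by exact_mod_cast Nat.pos_of_mul_pos_right hNd
  obtain ⟨ρ, hρ₀, hρ, hbalance⟩ := exists_balance (zero_lt_one.trans_le hd) M.cast_nonneg
    P.cast_nonneg hN
  set T := mainTerm d M P N
  have hdN : (N * d : ℝ) ≤ d ^ 2 * N := by
    rw [mul_comm]; gcongr; exact le_self_pow₀ hd two_ne_zero
  rcases le_or_gt (m : ℝ) ρ with hmρ | hρm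
  · calc (I : ℝ) ≤ m * (N * d) := by exact_mod_cast hm.trans_eq (mul_left_comm _ _ _)
      _ ≤ ρ * (N * d) := by gcongr
      _ ≤ 20 * (T + d ^ 2 * N) := by rw [hρ]; linarith [show (0 : ℝ) ≤ d ^ 2 * N by positivity]
  · obtain ⟨r, hr⟩ : ∃ r, r = ⌊ρ⌋₊ + 1 := ⟨_, rfl⟩
    have hρr : ρ ≤ r := by rw [hr]; exact_mod_cast (Nat.lt_floor_add_one ρ).le
    have hrρ : (r : ℝ) ≤ ρ + 1 := by
      rw [hr, Nat.cast_succ]; gcongr; exact Nat.floor_le hρ₀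
    have hrm : r ≤ m := by rw [hr]; exact (Nat.floor_lt hρ₀).mpr hρm
    have hr₀ : (0 : ℝ) < (r : ℝ) ^ 2 := by rw [hr]; positivity
    refine le_of_mul_le_mul_left ?_ hr₀
    calc (r : ℝ) ^ 2 * I
        ≤ r ^ 2 * (N * (16 * r * d + 4 * d ^ 2)) + 4 * M * P ^ 2 := by
          exact_mod_cast hcell r (hr ▸ Nat.succ_pos _) hrm
      _ = r ^ 2 * (16 * (r * (N * d)) + 4 * (d ^ 2 * N)) + 4 * (ρ ^ 2 * T) := by
          rw [← hbalance]; ring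
      _ ≤ r ^ 2 * (16 * ((ρ + 1) * (N * d)) + 4 * (d ^ 2 * N)) + 4 * (r ^ 2 * T) := by gcongr
      _ = r ^ 2 * (20 * T + 16 * (N * d) + 4 * (d ^ 2 * N)) := by rw [← hρ]; ring
      _ ≤ r ^ 2 * (20 * (T + d ^ 2 * N)) := by gcongr; linarith

theorem incidenceCount_le_of_not_containsAxisParallelLine {γ : Type*} {C : Finset γ}
    {F : γ → Poly2} {G : Fin 2 → Finset ℝ} {d M : ℕ}
    (hF : ∀ c ∈ C, ¬ContainsAxisParallelLine (zeroSet {F c})) (hd : ∀ c ∈ C, (F c).totalDegree ≤ d)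
    (hM : PairMultiplicityLE (Fintype.piFinset G) C (fun c => zeroSet {F c}) M) :
    (incidenceCount (Fintype.piFinset G) C (fun c => zeroSet {F c}) : ℝ) ≤
      20 * (mainTerm d M (Fintype.piFinset G).card C.card + d ^ 2 * C.card) := by
  classical
  obtain ⟨i, hi⟩ := Finite.exists_min fun i => (G i).card
  refine le_mainTerm_add_of_cell_bound (m := (G i).card) (incidenceCount_le_card_mul fun c hc => ?_)
    fun r hr hrm => sq_mul_incidenceCount_le hF hd hM hr fun j => hrm.trans (hi j)
  refine (card_le_card_mul_totalDegree (hF c hc) (i := i) (A := G i) (fun p hp => ?_)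
    fun p hp => (Finset.mem_filter.mp hp).2).trans (Nat.mul_le_mul_left _ (hd c hc))
  exact Fintype.mem_piFinset.mp (Finset.mem_filter.mp hp).1 i

theorem totalDegree_X_sub_C {σ R : Type*} [CommRing R] [Nontrivial R] (i : σ) (a : R) :
    (X i - C a : MvPolynomial σ R).totalDegree = 1 := by
  rw [sub_eq_add_neg, ← C_neg, totalDegree_add_eq_left_of_totalDegree_lt, totalDegree_X]
  rw [totalDegree_C, totalDegree_X]
  exact one_pos

section Substitution

variable {σ R : Type*} [DecidableEq σ] [CommRing R]

theorem X_sub_C_dvd_sub_aeval_update (i : σ) (a : R) (f : MvPolynomial σ R) :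
    X i - C a ∣ f - aeval (Function.update X i (C a)) f := by
  induction f using MvPolynomial.induction_on with
  | C c => simp [algebraMap_eq]
  | add p q hp hq => rw [map_add, add_sub_add_comm]; exact dvd_add hp hq
  | mul_X p j hp =>
    rw [map_mul, aeval_X]
    refine dvd_mul_sub_mul hp ?_
    rcases eq_or_ne j i with rfl | hj
    · rw [Function.update_self]
    · rw [Function.update_of_ne hj, sub_self]; exact dvd_zero _

theorem eval_aeval_update (i : σ) (a : R) (f : MvPolynomial σ R) (p : σ → R) :
    eval p (aeval (Function.update X i (C a)) f) = eval (Function.update p i a) f := by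
  have hcomp : (fun j => eval p (Function.update X i (C a) j)) = Function.update p i a := by
    ext j
    rcases eq_or_ne j i with rfl | hj
    · rw [Function.update_self, Function.update_self, eval_C]
    · rw [Function.update_of_ne hj, Function.update_of_ne hj, eval_X]
  have hconst : (eval p).comp (algebraMap R (MvPolynomial σ R)) = RingHom.id R :=
    RingHom.ext fun r => eval_C r
  rw [map_aeval, hcomp, hconst]
  rfl

end Substitution

theorem X_sub_C_dvd_of_forall_eval_eq_zero {σ R : Type*} [CommRing R] [IsDomain R] [Infinite R]
    {i : σ} {a : R} {f : MvPolynomial σ R} (h : ∀ p : σ → R, p i = a → eval p f = 0) :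
    X i - C a ∣ f := by
  classical
  have hzero : aeval (Function.update X i (C a)) f = 0 := MvPolynomial.funext fun p => by
    rw [eval_aeval_update, h _ (Function.update_self i a p), map_zero]
  simpa only [hzero, sub_zero] using X_sub_C_dvd_sub_aeval_update i a f

theorem exists_zeroSet_eq_union_line {f : Poly2} (hf : f ≠ 0)
    (h : ContainsAxisParallelLine (zeroSet {f})) :
    ∃ (g : Poly2) (i : Fin 2) (a : ℝ), g ≠ 0 ∧ f.totalDegree = g.totalDegree + 1 ∧
      zeroSet {f} = zeroSet {g} ∪ {p | p i = a} := by
  obtain ⟨i, a, hline⟩ := containsAxisParallelLine_iff.mp h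
  obtain ⟨g, rfl⟩ := X_sub_C_dvd_of_forall_eval_eq_zero fun p (hp : p i = a) =>
    mem_zeroSet_singleton.mp (hline hp)
  have hg := right_ne_zero_of_mul hf
  refine ⟨g, i, a, hg, ?_, ?_⟩
  · rw [totalDegree_mul_of_isDomain (left_ne_zero_of_mul hf) hg, totalDegree_X_sub_C, add_comm]
  · rw [zeroSet_singleton_mul, Set.union_comm]
    congr 1
    ext p
    simp [sub_eq_zero]

theorem exists_zeroSet_eq_union_lines {f : Poly2} (hf : f ≠ 0) :
    ∃ (g : Poly2) (W : Fin 2 → Finset ℝ), ¬ContainsAxisParallelLine (zeroSet {g}) ∧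
      g.totalDegree ≤ f.totalDegree ∧ (∀ i, (W i).card ≤ f.totalDegree) ∧
      zeroSet {f} = zeroSet {g} ∪ {p | ∃ i, p i ∈ W i} := by
  induction hn : f.totalDegree using Nat.strong_induction_on generalizing f with
  | _ n ih =>
  by_cases h : ContainsAxisParallelLine (zeroSet {f})
  · obtain ⟨g, i, a, hg, hdeg, hline⟩ := exists_zeroSet_eq_union_line hf h
    obtain ⟨g', W, hg', hdeg', hW, hlines⟩ := ih _ (by omega) hg rfl
    refine ⟨g', Function.update W i (insert a (W i)), hg', by omega, fun j => ?_, ?_⟩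
    · have hcard := (Finset.card_insert_le a (W i)).trans (Nat.succ_le_succ (hW i))
      rw [Function.update_apply]
      split_ifs
      · omega
      · exact (hW j).trans (by omega)
    · rw [hline, hlines, Set.union_assoc]
      congr 1
      ext p
      simp only [Set.mem_union, Set.mem_ofPred_eq, Function.update_apply]
      grind
  · exact ⟨f, fun _ => ∅, h, hn.le, by simp, by simp⟩

section LineIncidences

variable {γ : Type*} {C : Finset γ}

open Classical in
theorem incidenceCount_le_card_mul_of_forall_mem {α : Type*} {P : Finset α} {Z : γ → Set α} {M : ℕ}
    (h : ∀ p ∈ P, (C.filter fun c => p ∈ Z c).card ≤ M) : incidenceCount P C Z ≤ P.card * M := by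
  have hcount := Finset.sum_card_bipartiteAbove_eq_sum_card_bipartiteBelow (s := C) (t := P)
    (fun c p => p ∈ Z c)
  simp only [Finset.bipartiteAbove, Finset.bipartiteBelow] at hcount
  rw [incidenceCount, hcount]
  exact Finset.sum_le_card_nsmul P _ M h

theorem incidenceCount_piFinset_le {G : Fin 2 → Finset ℝ} {i j : Fin 2} (hij : i ≠ j)
    (Z : γ → Set ℝ) :
    incidenceCount (Fintype.piFinset G) C (fun c => {p | p i ∈ Z c}) ≤
      (G j).card * incidenceCount (G i) C Z := by
  classical
  rw [incidenceCount, incidenceCount, Finset.mul_sum]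
  refine Finset.sum_le_sum fun c _ => ?_
  rw [mul_comm, ← Finset.card_product]
  refine Finset.card_le_card_of_injOn (fun p => (p i, p j)) (fun p hp => ?_) fun p _ q _ hpq => ?_
  · obtain ⟨hpG, hpi⟩ := Finset.mem_filter.mp hp
    have hpG := Fintype.mem_piFinset.mp hpG
    exact Finset.mem_product.mpr ⟨Finset.mem_filter.mpr ⟨hpG i, hpi⟩, hpG j⟩
  · obtain ⟨hi, hj⟩ := Prod.mk.inj hpq
    ext k
    obtain rfl | rfl : k = i ∨ k = j := by omega
    exacts [hi, hj]

theorem PairMultiplicityLE.incidenceCount_le_card_mul {G : Fin 2 → Finset ℝ} {i j : Fin 2}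
    (hij : i ≠ j) {Z : γ → Set ℝ} {M : ℕ}
    (hM : PairMultiplicityLE (Fintype.piFinset G) C (fun c => {p | p i ∈ Z c}) M)
    (hj : 1 < (G j).card) : incidenceCount (G i) C Z ≤ (G i).card * M := by
  classical
  refine incidenceCount_le_card_mul_of_forall_mem fun a ha => ?_
  obtain ⟨b, hb, b', hb', hne⟩ := Finset.one_lt_card.mp hj
  let point (t : ℝ) : Plane := Function.update (fun _ => a) j t
  have hpoint (t) : point t i = a := Function.update_of_ne hij _ _
  have hmem (t) (ht : t ∈ G j) : point t ∈ Fintype.piFinset G := by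
    refine Fintype.mem_piFinset.mpr fun k => ?_
    obtain rfl | rfl : k = i ∨ k = j := by omega
    · rwa [hpoint]
    · simpa only [point, Function.update_self] using ht
  have hpoint_ne : point b ≠ point b' := (Function.update_injective _ j).ne hne
  simpa only [Set.mem_ofPred_eq, hpoint, and_self] using hM _ (hmem b hb) _ (hmem b' hb') hpoint_ne

theorem incidenceCount_lines_le {G : Fin 2 → Finset ℝ} {W : γ → Finset ℝ} {d M n : ℕ} (i : Fin 2)
    (hG : ∀ j, (G j).card ≤ n) (hW : ∀ c ∈ C, (W c).card ≤ d)
    (hM : PairMultiplicityLE (Fintype.piFinset G) C (fun c => {p | p i ∈ W c}) M) :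
    (incidenceCount (Fintype.piFinset G) C (fun c => {p | p i ∈ W c}) : ℝ) ≤
      mainTerm d M (n ^ 2) C.card + d ^ 2 * C.card := by
  classical
  obtain ⟨j, hji⟩ := exists_ne i
  have hgrid := incidenceCount_piFinset_le (G := G) (C := C) hji.symm fun c => (W c : Set ℝ)
  have hLd : incidenceCount (G i) C (fun c => (W c : Set ℝ)) ≤ C.card * d :=
    incidenceCount_le_card_mul fun c hc => (Finset.card_le_card fun a ha => by
      simp only [Finset.mem_filter, Finset.mem_coe] at ha
      exact ha.2).trans (hW c hc)
  have hLM := PairMultiplicityLE.incidenceCount_le_card_mul hji.symm hM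
  simp only [Finset.mem_coe] at hgrid
  generalize incidenceCount (G i) C (fun c => (W c : Set ℝ)) = L at hgrid hLd hLM
  generalize incidenceCount (Fintype.piFinset G) C (fun c => {p | p i ∈ W c}) = I at hgrid ⊢
  rcases le_or_gt (G j).card 1 with hj | hj
  · have hI : I ≤ d ^ 2 * C.card := calc
      I ≤ 1 * (C.card * d) := hgrid.trans (Nat.mul_le_mul hj hLd)
      _ = d * C.card := by ring
      _ ≤ d ^ 2 * C.card := Nat.mul_le_mul_right _ (Nat.le_self_pow two_ne_zero d)
    have hT : 0 ≤ mainTerm d M (n ^ 2) C.card := mainTerm_nonneg d.cast_nonneg M.cast_nonneg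
      (sq_nonneg _) C.card.cast_nonneg
    exact le_add_of_nonneg_of_le hT (by exact_mod_cast hI)
  · have hI : (I : ℝ) ≤ n * L := by exact_mod_cast hgrid.trans (Nat.mul_le_mul_right L (hG j))
    have hL : (L : ℝ) ≤ n * M := by
      exact_mod_cast (hLM hj).trans (Nat.mul_le_mul_right M (hG i))
    refine (hI.trans (mul_le_mainTerm d.cast_nonneg M.cast_nonneg n.cast_nonneg
      C.card.cast_nonneg L.cast_nonneg (by exact_mod_cast hLd) hL)).trans
      (le_add_of_nonneg_right (by positivity))

end LineIncidences

theorem incidenceCount_zeroSet_le {γ : Type*} {C : Finset γ} {F : γ → Poly2}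
    {G : Fin 2 → Finset ℝ} {d M n : ℕ} (hF : ∀ c ∈ C, F c ≠ 0)
    (hd : ∀ c ∈ C, (F c).totalDegree ≤ d) (hG : ∀ i, (G i).card ≤ n)
    (hM : PairMultiplicityLE (Fintype.piFinset G) C (fun c => zeroSet {F c}) M) :
    (incidenceCount (Fintype.piFinset G) C (fun c => zeroSet {F c}) : ℝ) ≤
      22 * (mainTerm d M (n ^ 2) C.card + d ^ 2 * C.card) := by
  choose! g W hg hgd hW hsplit using fun c hc => exists_zeroSet_eq_union_lines (hF c hc)
  have hsub₁ (c) (hc : c ∈ C) : zeroSet {g c} ⊆ zeroSet {F c} :=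
    hsplit c hc ▸ Set.subset_union_left
  have hsub₂ (i) (c) (hc : c ∈ C) : {p : Plane | p i ∈ W c i} ⊆ zeroSet {F c} :=
    hsplit c hc ▸ fun p hp => Or.inr ⟨i, hp⟩
  have hcurves := incidenceCount_le_of_not_containsAxisParallelLine hg
    (fun c hc => (hgd c hc).trans (hd c hc)) (hM.mono hsub₁)
  have hlines (i) := incidenceCount_lines_le i hG (fun c hc => (hW c hc i).trans (hd c hc))
    (hM.mono (hsub₂ i))
  have hsum : incidenceCount (Fintype.piFinset G) C (fun c => zeroSet {F c}) ≤
      incidenceCount (Fintype.piFinset G) C (fun c => zeroSet {g c}) +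
        (incidenceCount (Fintype.piFinset G) C (fun c => {p | p 0 ∈ W c 0}) +
          incidenceCount (Fintype.piFinset G) C (fun c => {p | p 1 ∈ W c 1})) := by
    refine (incidenceCount_le_add fun c hc => (hsplit c hc).subset).trans
      (Nat.add_le_add_left (incidenceCount_le_add fun c _ p hp => ?_) _)
    exact Fin.exists_fin_two.mp hp
  have hgrid : ((Fintype.piFinset G).card : ℝ) ≤ n ^ 2 := by
    rw [Fintype.card_piFinset]
    exact_mod_cast (Finset.prod_le_pow_card _ _ n fun i _ => hG i)
  have hmono := mainTerm_le_mainTerm (d := d) (M := M) d.cast_nonneg M.cast_nonneg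
    (Nat.cast_nonneg _) C.card.cast_nonneg hgrid
  have hsum' := (Nat.cast_le (α := ℝ)).mpr hsum
  push_cast at hsum'
  linarith [hlines 0, hlines 1]

theorem grid_eq_piFinset (A B : Finset ℝ) : grid A B = Fintype.piFinset ![A, B] := by
  ext p
  simp [grid, Fintype.mem_piFinset, Fin.forall_fin_two]

theorem card_grid (A B : Finset ℝ) : (grid A B).card = A.card * B.card := by
  rw [grid, Finset.card_map, Finset.card_product]

theorem card_incidences {P : Finset Plane} {C : Finset (Set Plane)} {Z : Set Plane → Set Plane}
    (hZ : ∀ c ∈ C, c = Z c) : (incidences P C).card = incidenceCount P C Z := by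
  classical
  rw [incidences, Finset.card_filter, Finset.sum_product_right]
  refine Finset.sum_congr rfl fun c hc => ?_
  simp only [← hZ c hc, Finset.card_filter]

theorem exists_zeroSet_singleton_eq (S : Finset Poly2) : ∃ f : Poly2, zeroSet {f} = zeroSet S := by
  refine ⟨∑ g ∈ S, g ^ 2, Set.ext fun p => ?_⟩
  rw [mem_zeroSet_singleton, map_sum, Finset.sum_eq_zero_iff_of_nonneg fun g _ => by
    rw [map_pow]; exact sq_nonneg _]
  simp only [map_pow, pow_eq_zero_iff two_ne_zero, zeroSet, Set.mem_ofPred_eq]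

theorem realDim_univ : realDim Set.univ = 2 := by
  have hbot : vanishingIdeal ℝ (Set.univ : Set Plane) = ⊥ := by
    refine eq_bot_iff.mpr fun f hf => (Submodule.mem_bot _).mpr (MvPolynomial.funext fun p => ?_)
    simpa [coe_aeval_eq_eval] using mem_vanishingIdeal_iff.mp hf p (Set.mem_univ p)
  rw [realDim, hbot, ringKrullDim_eq_of_ringEquiv (RingEquiv.quotientBot Poly2),
    MvPolynomial.ringKrullDim_of_isNoetherianRing]
  simp

theorem IsRealCurve.exists_equation {c : Set Plane} {d : ℕ} (hc : IsRealCurve c)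
    (hd : curveDegree c ≤ d) : ∃ f : Poly2, f ≠ 0 ∧ f.totalDegree ≤ d ∧ c = zeroSet {f} := by
  obtain ⟨⟨S, hS⟩, hdim⟩ := hc
  obtain ⟨g, hg⟩ := exists_zeroSet_singleton_eq S
  have hne : {n | ∃ f : Poly2, c = zeroSet {f} ∧ f.totalDegree = n}.Nonempty :=
    ⟨_, g, hS.trans hg.symm, rfl⟩
  obtain ⟨f, hf, hdeg⟩ := Nat.sInf_mem hne
  refine ⟨f, ?_, hdeg.trans_le hd, hf⟩
  rintro rfl
  have huniv : c = Set.univ := by simp [hf, Set.eq_univ_iff_forall]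
  rw [huniv, realDim_univ] at hdim
  exact absurd hdim (by decide)

end RealIncidence

end

open RealIncidence in
theorem mainTheorem11_general :
    (∃ K : ℝ, 0 < K ∧ ∀ (A B : Finset ℝ) (C : Finset (Set Plane)) (d M : ℕ),
        (∀ c ∈ C, ∃ f : Poly2, f.totalDegree ≤ d ∧ c = zeroSet {f}) →
        AtMostThroughTwo (grid A B) C M →
        (∀ c ∈ C, ¬ContainsAxisParallelLine c) →
        ((incidences (grid A B) C).card : ℝ) ≤
          K * (mainTerm d M (grid A B).card C.card + d ^ 2 * C.card)) ∧
    (∃ K : ℝ, 0 < K ∧ ∀ (A B : Finset ℝ) (C : Finset (Set Plane)) (d M n : ℕ),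
        A.card ≤ n → B.card ≤ n →
        (∀ c ∈ C, ∃ f : Poly2, f ≠ 0 ∧ f.totalDegree ≤ d ∧ c = zeroSet {f}) →
        AtMostThroughTwo (grid A B) C M →
        ((incidences (grid A B) C).card : ℝ) ≤
          K * (mainTerm d M (n ^ 2) C.card + d ^ 2 * C.card)) := by
  refine ⟨⟨20, by norm_num, fun A B C d M hC hM hline => ?_⟩,
    ⟨22, by norm_num, fun A B C d M n hA hB hC hM => ?_⟩⟩
  · choose! F hd hF using hC
    have hM' : PairMultiplicityLE _ C (fun c => zeroSet {F c}) M :=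
      PairMultiplicityLE.mono (Z := id) hM fun c hc => (hF c hc).superset
    rw [card_incidences hF]
    rw [grid_eq_piFinset] at hM' ⊢
    exact incidenceCount_le_of_not_containsAxisParallelLine
      (fun c hc => hF c hc ▸ hline c hc) hd hM'
  · choose! F hF₀ hd hF using hC
    have hM' : PairMultiplicityLE _ C (fun c => zeroSet {F c}) M :=
      PairMultiplicityLE.mono (Z := id) hM fun c hc => (hF c hc).superset
    rw [card_incidences hF]
    rw [grid_eq_piFinset] at hM' ⊢
    exact incidenceCount_zeroSet_le hF₀ hd (Fin.forall_fin_two.mpr ⟨hA, hB⟩) hM'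

theorem mainTheorem11 :
    (∃ K : ℝ, 0 < K ∧
      ∀ (A B : Finset ℝ) (C : Finset (Set RealIncidence.Plane)) (d M : ℕ),
        (∀ c ∈ C, RealIncidence.IsRealCurve c ∧ RealIncidence.curveDegree c ≤ d) →
        RealIncidence.AtMostThroughTwo (RealIncidence.grid A B) C M →
        (∀ c ∈ C, ¬ RealIncidence.ContainsAxisParallelLine c) →
        (d : ℝ) ^ 4 * (C.card : ℝ) ≤ (M : ℝ) * ((RealIncidence.grid A B).card : ℝ) ^ 2 →
        A.card ≤ B.card →
        (M : ℝ) * (B.card : ℝ) ^ 2 / (A.card : ℝ) ≤ (d : ℝ) * (C.card : ℝ) →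
        ((RealIncidence.incidences (RealIncidence.grid A B) C).card : ℝ) ≤
          K * ((d : ℝ) ^ (2 / 3 : ℝ) * (M : ℝ) ^ (1 / 3 : ℝ) *
            ((RealIncidence.grid A B).card : ℝ) ^ (2 / 3 : ℝ) *
            (C.card : ℝ) ^ (2 / 3 : ℝ))) ∧
    (∃ K : ℝ, 0 < K ∧
      ∀ (A B : Finset ℝ) (C : Finset (Set RealIncidence.Plane)) (d M : ℕ),
        A.card = B.card →
        (∀ c ∈ C, RealIncidence.IsRealCurve c ∧ RealIncidence.curveDegree c ≤ d) →
        RealIncidence.AtMostThroughTwo (RealIncidence.grid A B) C M →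
        ((RealIncidence.incidences (RealIncidence.grid A B) C).card : ℝ) ≤
          K * ((d : ℝ) ^ (2 / 3 : ℝ) * (M : ℝ) ^ (1 / 3 : ℝ) *
              ((RealIncidence.grid A B).card : ℝ) ^ (2 / 3 : ℝ) *
              (C.card : ℝ) ^ (2 / 3 : ℝ) +
            (M : ℝ) * (Real.log (M : ℝ) + Real.log (d : ℝ)) *
              ((RealIncidence.grid A B).card : ℝ) +
            (d : ℝ) ^ 2 * (C.card : ℝ))) := by
  obtain ⟨⟨K₁, hK₁, hcurves⟩, K₂, hK₂, hsquare⟩ := mainTheorem11_general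
  refine ⟨⟨2 * K₁, by positivity, fun A B C d M hC hM hline hd _ _ => ?_⟩,
    ⟨K₂, hK₂, fun A B C d M hAB hC hM => ?_⟩⟩
  · refine (hcurves A B C d M (fun c hc => ?_) hM hline).trans ?_
    · exact ((hC c hc).1.exists_equation (hC c hc).2).imp fun _ => And.right
    rw [mul_comm 2, mul_assoc]
    gcongr
    exact RealIncidence.mainTerm_add_le_two_mul_mainTerm d.cast_nonneg M.cast_nonneg
      (Nat.cast_nonneg _) C.card.cast_nonneg hd
  · have hlog : 0 ≤ (M : ℝ) * (Real.log M + Real.log d) * (RealIncidence.grid A B).card := by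
      positivity [Real.log_natCast_nonneg M, Real.log_natCast_nonneg d]
    have hcard : (A.card : ℝ) ^ 2 = (RealIncidence.grid A B).card := by
      rw [RealIncidence.card_grid, ← hAB, Nat.cast_mul, sq]
    refine (hsquare A B C d M A.card le_rfl hAB.ge
      (fun c hc => (hC c hc).1.exists_equation (hC c hc).2) hM).trans ?_
    rw [hcard, RealIncidence.mainTerm]
    gcongr
    exact le_add_of_nonneg_right hlog
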